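/- Let $k$ be a field and $\Pi$ a finite poset with its Alexandrov topology (open sets are the upward closed sets). A sheaf $F$ on $\Pi$ assigns a finite-dimensional $k$-vector space $F(\sigma)$ to each $\sigma\in\Pi$ and, functorially, a linear map $F(\sigma\le\tau):F(\sigma)\to F(\tau)$ to each relation $\sigma\le\tau$. For $\pi\in\Pi$ let $[\pi]$ be the indecomposable injective sheaf with $[\pi](\sigma)=k$ if $\sigma\le\pi$ and $0$ otherwise, whose map for $\sigma\le\tau$ is the identity if $\tau\le\pi$ and $0$ otherwise; every injective sheaf is a direct sum of such sheaves. A bounded complex $I^\bullet$ of injective sheaves (indexed by $\mathbb Z$) is minimal if for every bounded complex $J^\bullet$ of injective sheaves quasi-isomorphic to $I^\bullet$ and every $d$, the number of indecomposable summands of $I^d$ is at most that of $J^d$. For $\tau\in\Pi$ let $i_\tau:\{\tau\}\hookrightarrow\Pi$ be the inclusion, $i_\tau^*F=F(\tau)$ and $i_\tau^!F=\{v\in F(\tau): F(\tau\le\sigma)(v)=0\text{ for all }\sigma>\tau\}$, regarded as sheaves on the one-point poset, and let $Ri_\tau^*I^\bullet$, $Ri_\tau^!I^\bullet$ be the minimal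 injective resolutions (quasi-isomorphic minimal complexes of injectives) of the complexes obtained by applying $i_\tau^*$, $i_\tau^!$ termwise. Put \[ \operatorname{supp}^*I^\bullet=\{\tau\in\Pi: H^j(Ri_\tau^*I^\bullet)\ne0\text{ for some }j\in\mathbb Z\},\qquad \operatorname{supp}^!I^\bullet=\{\tau\in\Pi: H^j(Ri_\tau^!I^\bullet)\ne0\text{ for some }j\in\mathbb Z\}. \] Proposition. Let $I^\bullet$ be a minimal complex of injective sheaves on $\Pi$, and let $n^d_{I^\bullet}(\pi)$ be the multiplicity of $[\pi]$ as a direct summand of $I^d$. Then for every $\pi\in\Pi$, \[ \pi\notin\operatorname{supp}^!I^\bullet\iff n^d_{I^\bullet}(\pi)=0\text{ for all }d\in\mathbb Z . \] Moreover, the closures in the Alexandrov topology satisfy $\operatorname{Cl}\operatorname{supp}^!I^\bullet=\operatorname{Cl}\operatorname{supp}^*I^\bullet$. -/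

import Mathlib

open CategoryTheory CategoryTheory.Limits

universe u v w

noncomputable section

namespace PosetSheaf

/-- A sheaf of finite-dimensional `k`-vector spaces on a poset `Π`: a vector space for each element
and a linear map for each relation, functorially. Morphisms are natural transformations; injective
sheaves are the `Injective` objects of this category. -/
abbrev Sheaf (k : Type u) [Field k] (P : Type v) [PartialOrder P] := P ⥤ FGModuleCat.{u} k

/-- (Not necessarily bounded) cochain complexes of sheaves, indexed by `ℤ`. -/
abbrev Complex (k : Type u) [Field k] (P : Type v) [PartialOrder P] :=
  CochainComplex (Sheaf k P) ℤ

instance (k : Type u) [Field k] (P : Type v) [PartialOrder P] :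
    HasFiniteBiproducts (Sheaf k P) :=
  Abelian.hasFiniteBiproducts

section Indecomposable

variable (k : Type u) [Field k] {P : Type v} [PartialOrder P]

/-- The indecomposable injective sheaf `[π]`. Its value at `σ` is the space of functions from the
proofs of `σ ≤ π` to `k`, that is, `k` if `σ ≤ π` and `0` otherwise; the map attached to `σ ≤ τ`
is the identity of `k` if `τ ≤ π` and is `0` otherwise. -/
def indec (π : P) : Sheaf k P where
  obj σ := FGModuleCat.of k (PLift (σ ≤ π) → k)
  map {_ τ} f := FGModuleCat.ofHom
    (LinearMap.funLeft k k fun h : PLift (τ ≤ π) => PLift.up ((leOfHom f).trans h.down))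
  map_id _ := rfl
  map_comp _ _ := rfl

variable {k}

/-- The multiplicity of `[π]` in a sheaf `F`: the largest `n` for which `[π]^n` is a direct summand
of `F`. (Such `n` are bounded by `dim F(π)`. If `F` is a direct sum of sheaves `[σ]`, this is the
number of summands `[π]` in any such decomposition.) -/
def multiplicity (F : Sheaf k P) (π : P) : ℕ :=
  sSup {n : ℕ | ∃ G : Sheaf k P, Nonempty (F ≅ (⨁ fun _ : Fin n => indec k π) ⊞ G)}

/-- The number of indecomposable summands of an injective sheaf on a finite poset. -/
def numSummands (F : Sheaf k P) : ℕ :=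
  ∑ᶠ π : P, multiplicity F π

end Indecomposable

section Minimal

variable {k : Type u} [Field k] {P : Type v} [PartialOrder P]

/-- A bounded complex of injective sheaves. -/
structure IsBoundedInjective (I : Complex k P) : Prop where
  bounded : ∃ N : ℕ, ∀ d : ℤ, (N : ℤ) < |d| → IsZero (I.X d)
  injective : ∀ d : ℤ, Injective (I.X d)

/-- Two complexes are quasi-isomorphic if they are joined by a zigzag of quasi-isomorphisms. -/
def QuasiIsomorphic (I J : Complex k P) : Prop :=
  Relation.EqvGen (fun A B : Complex k P => ∃ f : A ⟶ B, QuasiIso f) I J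

/-- Minimal complexes of injective sheaves: the objects of the bounded derived category. -/
structure IsMinimal (I : Complex k P) : Prop extends IsBoundedInjective I where
  minimal : ∀ J : Complex k P, IsBoundedInjective J → QuasiIsomorphic I J →
    ∀ d : ℤ, numSummands (I.X d) ≤ numSummands (J.X d)

/-- `K` is a minimal injective resolution of the complex `A`. -/
def IsMinimalInjectiveResolution (A K : Complex k P) : Prop :=
  IsMinimal K ∧ ∃ α : A ⟶ K, QuasiIso α

end Minimal

section Functors

variable {k : Type u} [Field k] {P : Type v} [PartialOrder P] {Q : Type w} [PartialOrder Q]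

/-- The pullback `f^*` along an order preserving map `f`: `(f^* F)(p) = F(f p)`. -/
def pullback (k : Type u) [Field k] (f : P →o Q) : Sheaf k Q ⥤ Sheaf k P :=
  (Functor.whiskeringLeft P Q (FGModuleCat.{u} k)).obj f.monotone.functor

instance (f : P →o Q) : (pullback k f).PreservesZeroMorphisms where
  map_zero _ _ := rfl

/-- The sections of `F` at `ζ ∈ Z` that vanish at all `τ ≥ ζ` outside `Z`. -/
def properSections (F : Sheaf k P) (Z : Set P) (ζ : Z) : Submodule k (F.obj ζ) where
  carrier := {v | ∀ (τ : P) (h : (ζ : P) ≤ τ), τ ∉ Z → (F.map (homOfLE h)).hom.hom v = 0}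
  zero_mem' τ h _ := map_zero _
  add_mem' {a b} ha hb τ h hτ := by rw [map_add, ha τ h hτ, hb τ h hτ, add_zero]
  smul_mem' c a ha τ h hτ := by rw [map_smul, ha τ h hτ, smul_zero]

theorem properSections_map (F : Sheaf k P) (Z : Set P) {ζ ξ : Z} (h : (ζ : P) ≤ ξ)
    (a : F.obj ζ) (ha : a ∈ properSections F Z ζ) :
    (F.map (homOfLE h)).hom.hom a ∈ properSections F Z ξ := by
  intro τ h' hτ
  have := ha τ (h.trans h') hτ
  rw [← homOfLE_comp h h', F.map_comp] at this
  exact this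

theorem properSections_app {F G : Sheaf k P} (η : F ⟶ G) (Z : Set P) (ζ : Z)
    (a : F.obj ζ) (ha : a ∈ properSections F Z ζ) :
    (η.app (ζ : P)).hom.hom a ∈ properSections G Z ζ := by
  intro τ h hτ
  have h1 := congrArg (fun t => t.hom.hom a) (η.naturality (homOfLE h))
  have h2 : (G.map (homOfLE h)).hom.hom ((η.app (ζ : P)).hom.hom a) =
      (η.app τ).hom.hom ((F.map (homOfLE h)).hom.hom a) := h1.symm
  rw [h2, ha τ h hτ, map_zero]

/-- The proper pullback `i_Z^!` along the inclusion of a (locally closed) subset `Z`; its linear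
maps are the restrictions of those of `F`. -/
def properPullback (k : Type u) [Field k] (Z : Set P) : Sheaf k P ⥤ Sheaf k Z where
  obj F :=
    { obj := fun ζ => FGModuleCat.of k (properSections F Z ζ)
      map := fun {ζ ξ} f => FGModuleCat.ofHom
        ((F.map (homOfLE (leOfHom f : (ζ : P) ≤ ξ))).hom.hom.restrict
          (properSections_map F Z (leOfHom f)))
      map_id := fun ζ => by
        apply FGModuleCat.hom_ext
        ext a
        change (F.map (𝟙 (ζ : P))).hom.hom a.1 = a.1
        rw [F.map_id]
        rfl
      map_comp := fun {ζ ξ χ} f g => by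
        apply FGModuleCat.hom_ext
        ext a
        change (F.map (homOfLE (leOfHom f : (ζ : P) ≤ ξ) ≫
          homOfLE (leOfHom g : (ξ : P) ≤ χ))).hom.hom a.1 = _
        rw [F.map_comp]
        rfl }
  map {F G} η :=
    { app := fun ζ => FGModuleCat.ofHom
        ((η.app (ζ : P)).hom.hom.restrict (properSections_app η Z ζ))
      naturality := fun ζ ξ f => by
        apply FGModuleCat.hom_ext
        ext a
        exact congrArg (fun t => t.hom.hom a.1)
          (η.naturality (homOfLE (leOfHom f : (ζ : P) ≤ ξ))) }
  map_id _ := rfl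
  map_comp _ _ := rfl

instance (Z : Set P) : (properPullback k Z).PreservesZeroMorphisms where
  map_zero _ _ := rfl

/-- `K` is (a representative of) `RF(I)`: a minimal injective resolution of the complex obtained by
applying `F` to `I` termwise. For minimal `I`, it exists and is unique up to isomorphism. -/
def IsDerivedImage (F : Sheaf k P ⥤ Sheaf k Q) [F.PreservesZeroMorphisms]
    (I : Complex k P) (K : Complex k Q) : Prop :=
  IsMinimalInjectiveResolution ((F.mapHomologicalComplex (ComplexShape.up ℤ)).obj I) K

end Functors

section Support

variable {k : Type u} [Field k] {P : Type v} [PartialOrder P]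

/-- The `*`-support: the elements `τ` with `H^j (R i_τ^* I) ≠ 0` for some `j`, where `i_τ` is the
inclusion of the one-element poset `{τ}`. -/
def starSupport (I : Complex k P) : Set P :=
  {τ | ∃ K : Complex k ({τ} : Set P),
    IsDerivedImage (pullback k (OrderHom.Subtype.val (· ∈ ({τ} : Set P)))) I K ∧
      ∃ j : ℤ, ¬ IsZero (K.homology j)}

/-- The `!`-support: the elements `τ` with `H^j (R i_τ^! I) ≠ 0` for some `j`. -/
def shriekSupport (I : Complex k P) : Set P :=
  {τ | ∃ K : Complex k ({τ} : Set P),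
    IsDerivedImage (properPullback k ({τ} : Set P)) I K ∧ ∃ j : ℤ, ¬ IsZero (K.homology j)}

/-- Closure in the Alexandrov topology, whose open sets are the upward closed sets. -/
def alexandrovClosure (S : Set P) : Set P :=
  @closure P (Topology.upperSet P) S

end Support

end PosetSheaf

end

/-! Everything is controlled by the proper stalk `properStalk F π`, the sections at `π` that die at
every larger element. For injective `F` its dimension is the multiplicity of `[π]`
(`multiplicity_eq_finrank`): a proper section is a map from the simple sheaf at `π`, extends to
`[π]` by injectivity, and splits off.

If a differential of a minimal complex were nonzero on a proper section, an acyclic subcomplex `[π]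
= [π]` would split off termwise, leaving a smaller quasi-isomorphic complex. So differentials vanish
on proper stalks (`IsMinimal.d_eq_zero`), the complex `i_π^! I` is its own minimal resolution, and
`π` lies in the `!`-support iff some proper stalk at `π` is nonzero.

Closures are lower closures. By finiteness a nonzero section restricts to a nonzero proper section
at some larger element, so the `*`-support lies below the `!`-support. Conversely, at a maximal
element of the `!`-support all sections are proper, so `i^*` and `i^!` agree there. -/

noncomputable section

namespace PosetSheaf

/-! ### Morphisms of sheaves as compatible families of linear maps. -/

section Basic

variable {k : Type u} [Field k] {P : Type v} [PartialOrder P]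

/-- The component of a morphism of sheaves at `σ`, as a linear map. -/
def component {F G : Sheaf k P} (η : F ⟶ G) (σ : P) : F.obj σ →ₗ[k] G.obj σ :=
  (η.app σ).hom.hom

/-- The restriction map of a sheaf attached to `σ ≤ τ`. -/
def restriction (F : Sheaf k P) {σ τ : P} (h : σ ≤ τ) : F.obj σ →ₗ[k] F.obj τ :=
  (F.map (homOfLE h)).hom.hom

theorem hom_ext_component {F G : Sheaf k P} {η θ : F ⟶ G}
    (h : ∀ σ x, component η σ x = component θ σ x) : η = θ := by
  apply NatTrans.ext
  funext σ
  apply FGModuleCat.hom_ext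
  exact LinearMap.ext (h σ)

@[simp]
theorem component_id (F : Sheaf k P) (σ : P) (x : F.obj σ) : component (𝟙 F) σ x = x := rfl

@[simp]
theorem component_comp {F G H : Sheaf k P} (η : F ⟶ G) (θ : G ⟶ H) (σ : P) (x : F.obj σ) :
    component (η ≫ θ) σ x = component θ σ (component η σ x) := rfl

@[simp]
theorem component_zero {F G : Sheaf k P} (σ : P) (x : F.obj σ) :
    component (0 : F ⟶ G) σ x = 0 := rfl

theorem component_restriction {F G : Sheaf k P} (η : F ⟶ G) {σ τ : P} (h : σ ≤ τ)
    (x : F.obj σ) :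
    component η τ (restriction F h x) = restriction G h (component η σ x) :=
  congrArg (fun t => t.hom.hom x) (η.naturality (homOfLE h))

@[simp]
theorem restriction_refl (F : Sheaf k P) {σ : P} (h : σ ≤ σ) (x : F.obj σ) :
    restriction F h x = x := by
  change (F.map (𝟙 σ)).hom.hom x = x
  rw [F.map_id]
  rfl

theorem restriction_restriction (F : Sheaf k P) {σ τ ρ : P} (h : σ ≤ τ) (h' : τ ≤ ρ)
    (x : F.obj σ) :
    restriction F h' (restriction F h x) = restriction F (h.trans h') x := by
  change _ = (F.map (homOfLE h ≫ homOfLE h')).hom.hom x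
  rw [F.map_comp]
  rfl

/-- A morphism of sheaves from a compatible family of linear maps. -/
def homMk {F G : Sheaf k P} (φ : ∀ σ, F.obj σ →ₗ[k] G.obj σ)
    (h : ∀ {σ τ : P} (h : σ ≤ τ) (x : F.obj σ),
      φ τ (restriction F h x) = restriction G h (φ σ x)) : F ⟶ G where
  app σ := FGModuleCat.ofHom (φ σ)
  naturality σ τ f := by
    apply FGModuleCat.hom_ext
    exact LinearMap.ext fun x => h (leOfHom f) x

theorem mono_of_component_injective {F G : Sheaf k P} (η : F ⟶ G)
    (h : ∀ σ, Function.Injective (component η σ)) : Mono η where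
  right_cancellation α β e := by
    apply hom_ext_component
    intro σ x
    apply h σ
    rw [← component_comp, e, component_comp]

theorem component_injective_of_mono {F G : Sheaf k P} (η : F ⟶ G) [Mono η] (σ : P) :
    Function.Injective (component η σ) := by
  have h1 : Mono (η.app σ) := inferInstance
  have h2 : Mono ((forget₂ (FGModuleCat k) (ModuleCat k)).map (η.app σ)) := inferInstance
  exact (ModuleCat.mono_iff_injective _).1 h2

theorem component_surjective_of_epi {F G : Sheaf k P} (η : F ⟶ G) [Epi η] (σ : P) :
    Function.Surjective (component η σ) := by
  have h1 : Epi (η.app σ) := inferInstance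
  have h2 : Epi ((forget₂ (FGModuleCat k) (ModuleCat k)).map (η.app σ)) := inferInstance
  exact (ModuleCat.epi_iff_surjective _).1 h2

theorem isZero_iff_subsingleton (F : Sheaf k P) :
    IsZero F ↔ ∀ (σ : P) (x : F.obj σ), x = 0 := by
  constructor
  · intro h σ x
    have := h.eq_of_src (𝟙 F) 0
    rw [← component_id F σ x, this, component_zero]
  · intro h
    rw [IsZero.iff_id_eq_zero]
    exact hom_ext_component fun σ x => by rw [component_id, h σ x]; simp

end Basic

/-! ### Proper sections, and morphisms to and from `[π]`. -/

section Stalk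

variable {k : Type u} [Field k] {P : Type v} [PartialOrder P]

/-- The stalk at `π` of the proper pullback of `F` to `{π}`. -/
abbrev properStalk (F : Sheaf k P) (π : P) : Submodule k (F.obj π) :=
  properSections F {π} ⟨π, rfl⟩

theorem mem_properStalk {F : Sheaf k P} {π : P} {v : F.obj π} :
    v ∈ properStalk F π ↔ ∀ (τ : P) (h : π ≤ τ), τ ≠ π → restriction F h v = 0 := Iff.rfl

theorem component_mem_properStalk {F G : Sheaf k P} (η : F ⟶ G) {π : P} {v : F.obj π}
    (hv : v ∈ properStalk F π) : component η π v ∈ properStalk G π :=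
  properSections_app η {π} ⟨π, rfl⟩ v hv

/-- The generator of the stalk of `[π]` at `π`. -/
def indecOne (k : Type u) [Field k] (π : P) : (indec k π).obj π :=
  fun _ => (1 : k)

theorem indecOne_mem (π : P) : indecOne k π ∈ properStalk (indec k π) π := by
  rw [mem_properStalk]
  intro τ h hτ
  funext hp
  exact absurd (le_antisymm hp.down h) hτ

theorem indecOne_ne_zero (π : P) : indecOne k π ≠ 0 := by
  intro h
  exact one_ne_zero (congrFun h (PLift.up le_rfl) : (1 : k) = 0)

theorem eq_smul_indecOne {π : P} (x : (indec k π).obj π) :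
    ∃ c : k, x = c • indecOne k π := by
  refine ⟨(x : PLift (π ≤ π) → k) ⟨le_rfl⟩, ?_⟩
  funext h
  exact (mul_one _).symm

theorem indec_restriction_injective {π σ : P} (h : σ ≤ π) :
    Function.Injective (restriction (indec k π) h) := by
  intro x y hxy
  funext hp
  exact (congrFun hxy ⟨le_rfl⟩ : _)

theorem indec_eq_zero {π σ : P} (h : ¬ σ ≤ π) (x : (indec k π).obj σ) : x = 0 := by
  funext hp
  exact absurd hp.down h

/-- The morphism to `[π]` determined by a linear functional on the stalk at `π`. -/
def toIndec {F : Sheaf k P} {π : P} (φ : F.obj π →ₗ[k] k) : F ⟶ indec k π :=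
  homMk (fun σ => (LinearMap.pi fun h : PLift (σ ≤ π) => φ ∘ₗ restriction F h.down :
      F.obj σ →ₗ[k] (PLift (σ ≤ π) → k))) (by
    intro σ τ h x
    funext hp
    exact congrArg φ (restriction_restriction F h hp.down x))

theorem toIndec_component {F : Sheaf k P} {π : P} (φ : F.obj π →ₗ[k] k) (x : F.obj π) :
    component (toIndec φ) π x = φ x • indecOne k π := by
  funext hp
  change φ (restriction F hp.down x) = φ x * 1
  rw [restriction_refl, mul_one]

/-- Below `π` the sheaf `[π]` embeds into its stalk at `π`, and elsewhere it is zero. With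
`toIndec`, morphisms `F ⟶ [π]` thus amount to functionals on `F(π)`. -/
theorem hom_to_indec_ext {F : Sheaf k P} {π : P} {η θ : F ⟶ indec k π}
    (h : ∀ x, component η π x = component θ π x) : η = θ := by
  apply hom_ext_component
  intro σ x
  by_cases hσ : σ ≤ π
  · apply indec_restriction_injective hσ
    rw [← component_restriction, ← component_restriction, h]
  · rw [indec_eq_zero hσ (component η σ x), indec_eq_zero hσ (component θ σ x)]

/-- The coordinate on the stalk of `[π]` at `π`. -/
def indecCoord (k : Type u) [Field k] (π : P) : (indec k π).obj π →ₗ[k] k :=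
  (LinearMap.proj (PLift.up le_rfl) : (PLift (π ≤ π) → k) →ₗ[k] k)

@[simp]
theorem indecCoord_one (π : P) : indecCoord k π (indecOne k π) = 1 := rfl

instance injective_indec (π : P) : Injective (indec k π) where
  factors {A B} g f _ := by
    obtain ⟨r, hr⟩ := LinearMap.exists_leftInverse_of_injective (component f π)
      (LinearMap.ker_eq_bot.2 (component_injective_of_mono f π))
    refine ⟨toIndec (indecCoord k π ∘ₗ component g π ∘ₗ r), ?_⟩
    apply hom_to_indec_ext
    intro x
    rw [component_comp, toIndec_component]
    have : r (component f π x) = x := LinearMap.congr_fun hr x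
    simp only [LinearMap.comp_apply, this]
    obtain ⟨c, hc⟩ := eq_smul_indecOne (component g π x)
    rw [hc, map_smul, indecCoord_one, smul_eq_mul, mul_one]

/-- The simple subsheaf of `[π]` supported at `π`. -/
def simpleSheaf (k : Type u) [Field k] (π : P) : Sheaf k P where
  obj σ := FGModuleCat.of k
    ({ carrier := {x | σ ≠ π → x = 0}
       zero_mem' := fun _ => rfl
       add_mem' := fun {a b} ha hb h => by rw [ha h, hb h, add_zero]
       smul_mem' := fun c a ha h => by rw [ha h, smul_zero] } :
      Submodule k ((indec k π).obj σ))
  map {σ τ} f := FGModuleCat.ofHom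
    ((restriction (indec k π) (leOfHom f)).restrict (by
      intro x hx hτ
      by_cases hσ : σ = π
      · subst hσ
        exact indec_eq_zero (fun h => hτ (le_antisymm h (leOfHom f))) _
      · rw [hx hσ, map_zero]))
  map_id _ := rfl
  map_comp _ _ := rfl

/-- The inclusion of the simple sheaf at `π` into `[π]`. -/
def simpleSheafι (k : Type u) [Field k] (π : P) : simpleSheaf k π ⟶ indec k π :=
  homMk (fun _ => Submodule.subtype _) (fun _ _ => rfl)

instance (π : P) : Mono (simpleSheafι k π) :=
  mono_of_component_injective _ fun _ => Subtype.val_injective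

open scoped Classical in
/-- The morphism from the simple sheaf at `π` determined by a proper section. -/
def fromSimpleSheaf {F : Sheaf k P} {π : P} (v : F.obj π) (hv : v ∈ properStalk F π) :
    simpleSheaf k π ⟶ F :=
  homMk (fun σ =>
      -- Two inequalities replace `σ = π`: one gives the coordinate, the other the restriction of
      -- `v`, with no transport along an equality.
      if h : π ≤ σ ∧ σ ≤ π then
        (((LinearMap.proj (PLift.up h.2) : (PLift (σ ≤ π) → k) →ₗ[k] k) ∘ₗ
          component (simpleSheafι k π) σ).smulRight (restriction F h.1 v))
      else 0) (by
    intro σ τ h x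
    by_cases hσ : σ = π
    · subst hσ
      rw [dif_pos (show σ ≤ σ ∧ σ ≤ σ from ⟨le_rfl, le_rfl⟩)]
      by_cases hτ : τ = σ
      · subst hτ
        rw [dif_pos ⟨le_rfl, le_rfl⟩]
        simp
      · rw [dif_neg (fun h' => hτ (le_antisymm h'.2 h'.1))]
        simp [mem_properStalk.1 hv τ h hτ]
    · have hx : x = 0 := Subtype.ext (x.2 hσ)
      rw [hx]
      simp)

/-- A proper section of an injective sheaf at `π` extends to a morphism from `[π]`. -/
theorem exists_hom_of_mem_properStalk {F : Sheaf k P} [Injective F] {π : P} {v : F.obj π}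
    (hv : v ∈ properStalk F π) :
    ∃ e : indec k π ⟶ F, component e π (indecOne k π) = v := by
  refine ⟨Injective.factorThru (fromSimpleSheaf v hv) (simpleSheafι k π), ?_⟩
  let s : (simpleSheaf k π).obj π := ⟨indecOne k π, fun h => absurd rfl h⟩
  change component _ π (component (simpleSheafι k π) π s) = v
  rw [← component_comp, Injective.comp_factorThru]
  refine (LinearMap.congr_fun (dif_pos ⟨le_rfl, le_rfl⟩) s).trans ?_
  change (1 : k) • restriction F le_rfl v = v
  simp

end Stalk

/-! ### Multiplicities as dimensions of proper stalks. -/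

section Multiplicity

variable {k : Type u} [Field k] {P : Type v} [PartialOrder P]

/-- The generators of the `n` copies of `[π]` are proper sections, and the projections separate
them. -/
theorem le_finrank_of_iso {F G : Sheaf k P} {π : P} {n : ℕ}
    (e : F ≅ (⨁ fun _ : Fin n => indec k π) ⊞ G) :
    n ≤ Module.finrank k (properStalk F π) := by
  classical
  let ι (i : Fin n) : indec k π ⟶ F :=
    biproduct.ι (fun _ : Fin n => indec k π) i ≫ biprod.inl ≫ e.inv
  let p (i : Fin n) : F ⟶ indec k π :=
    e.hom ≫ biprod.fst ≫ biproduct.π (fun _ : Fin n => indec k π) i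
  have hip (i j : Fin n) : ι i ≫ p j = if i = j then 𝟙 _ else 0 := by
    simp only [ι, p, Category.assoc, Iso.inv_hom_id_assoc, BinaryBicone.inl_fst_assoc]
    rw [biproduct.ι_π]
    rfl
  let w (i : Fin n) : properStalk F π :=
    ⟨component (ι i) π (indecOne k π), component_mem_properStalk _ (indecOne_mem π)⟩
  have hw : LinearIndependent k w := by
    rw [Fintype.linearIndependent_iff]
    intro g hg i
    have h1 := congrArg (fun t : properStalk F π => component (p i) π (t : F.obj π)) hg
    simp only [w, AddSubmonoidClass.coe_finsetSum, Submodule.coe_smul, map_sum, map_smul,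
      ← component_comp, hip, ZeroMemClass.coe_zero, map_zero] at h1
    rw [Finset.sum_eq_single i (fun j _ hj => by rw [if_neg hj, component_zero, smul_zero])
      (by simp), if_pos rfl, component_id] at h1
    exact (smul_eq_zero.1 h1).resolve_right (indecOne_ne_zero π)
  simpa using hw.fintype_card_le_finrank

/-- A basis of the proper stalk gives maps `e i` out of `[π]`; its coordinates, extended to the
whole stalk by the retraction `r`, give dual maps `p j` back. Hence the sum of the `e i` is a split
mono. -/
theorem exists_iso_of_injective (F : Sheaf k P) [Injective F] (π : P) :
    ∃ G : Sheaf k P, Nonempty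
      (F ≅ (⨁ fun _ : Fin (Module.finrank k (properStalk F π)) => indec k π) ⊞ G) := by
  classical
  let b := Module.finBasis k (properStalk F π)
  choose e he using fun i => exists_hom_of_mem_properStalk (b i).2
  obtain ⟨r, hr⟩ := LinearMap.exists_leftInverse_of_injective (properStalk F π).subtype
    (Submodule.ker_subtype _)
  let p i : F ⟶ indec k π := toIndec (b.coord i ∘ₗ r)
  have hep i j : e i ≫ p j = if i = j then 𝟙 _ else 0 := by
    apply hom_to_indec_ext
    intro x
    obtain ⟨c, rfl⟩ := eq_smul_indecOne x
    have h1 : r (b i) = b i := LinearMap.congr_fun hr (b i)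
    rw [component_comp, map_smul, map_smul, he, toIndec_component, LinearMap.comp_apply, h1,
      Module.Basis.coord_apply, Module.Basis.repr_self, Finsupp.single_apply]
    split_ifs <;> simp
  have hsplit : biproduct.desc e ≫ biproduct.lift p = 𝟙 _ := by
    apply biproduct.hom_ext'
    intro i
    apply biproduct.hom_ext
    intro j
    simp only [biproduct.ι_desc_assoc, Category.assoc, biproduct.lift_π, hep, Category.comp_id, biproduct.ι_π]
    rfl
  have hm : Mono (biproduct.desc e) := mono_of_mono_fac hsplit
  let S := ShortComplex.mk (biproduct.desc e) (cokernel.π (biproduct.desc e)) (by simp)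
  have hS : S.Exact := ShortComplex.exact_cokernel _
  exact ⟨_, ⟨(ShortComplex.Splitting.ofExactOfRetraction S hS (biproduct.lift p) hsplit
    inferInstance).isoBinaryBiproduct⟩⟩

/-- The multiplicity of `[π]` in an injective sheaf is the dimension of its proper stalk. -/
theorem multiplicity_eq_finrank (F : Sheaf k P) [Injective F] (π : P) :
    multiplicity F π = Module.finrank k (properStalk F π) := by
  apply le_antisymm
  · refine csSup_le ⟨Module.finrank k (properStalk F π), exists_iso_of_injective F π⟩ ?_
    rintro n ⟨G, ⟨e⟩⟩
    exact le_finrank_of_iso e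
  -- The upper bound is essential: `sSup` of an unbounded set of naturals is `0`.
  · refine le_csSup ⟨Module.finrank k (properStalk F π), ?_⟩ (exists_iso_of_injective F π)
    rintro n ⟨G, ⟨e⟩⟩
    exact le_finrank_of_iso e

theorem multiplicity_eq_zero_iff (F : Sheaf k P) [Injective F] (π : P) :
    multiplicity F π = 0 ↔ properStalk F π = ⊥ := by
  rw [multiplicity_eq_finrank, Submodule.finrank_eq_zero]

/-- A morphism of injective sheaves that is injective on stalks does not decrease
multiplicities. -/
theorem multiplicity_le_of_injective {F G : Sheaf k P} [Injective F] [Injective G] (η : F ⟶ G)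
    {π : P} (h : Function.Injective (component η π)) : multiplicity F π ≤ multiplicity G π := by
  rw [multiplicity_eq_finrank, multiplicity_eq_finrank]
  apply LinearMap.finrank_le_finrank_of_injective
    (f := (component η π).restrict fun _ => component_mem_properStalk η)
  intro x y hxy
  exact Subtype.ext (h (congrArg Subtype.val hxy))

end Multiplicity

/-! ### Comparing numbers of summands. -/

section SplitOff

variable {k : Type u} [Field k] {P : Type v} [PartialOrder P]

theorem numSummands_le_of_mono [Finite P] {F G : Sheaf k P} [Injective F] [Injective G]
    (η : F ⟶ G) [Mono η] : numSummands F ≤ numSummands G := by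
  have := Fintype.ofFinite P
  rw [numSummands, numSummands, finsum_eq_sum_of_fintype, finsum_eq_sum_of_fintype]
  exact Finset.sum_le_sum fun π _ =>
    multiplicity_le_of_injective η (component_injective_of_mono η π)

/-- Splitting off a summand `[π]` strictly decreases the number of summands. -/
theorem numSummands_lt_of_splitting [Finite P] {S : ShortComplex (Sheaf k P)} (s : S.Splitting)
    [Injective S.X₂] [Injective S.X₃] {π : P} (e : S.X₁ ≅ indec k π) :
    numSummands S.X₃ < numSummands S.X₂ := by
  have hinj σ : Function.Injective (component s.s σ) := by
    intro x y h
    rw [← component_id S.X₃ σ x, ← component_id S.X₃ σ y, ← s.s_g, component_comp, h,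
      component_comp]
  have := Fintype.ofFinite P
  rw [numSummands, numSummands, finsum_eq_sum_of_fintype, finsum_eq_sum_of_fintype]
  refine Finset.sum_lt_sum (fun σ _ => multiplicity_le_of_injective s.s (hinj σ))
    ⟨π, Finset.mem_univ π, ?_⟩
  refine lt_of_le_of_ne (multiplicity_le_of_injective s.s (hinj π)) fun heq => ?_
  -- Equality would make `s.s` surjective on proper stalks, so the image of the generator `w` of
  -- `S.X₁` would come from `S.X₃`; then `s.r` kills it, although `s.r` returns `w`.
  rw [multiplicity_eq_finrank, multiplicity_eq_finrank] at heq
  let f : properStalk S.X₃ π →ₗ[k] properStalk S.X₂ π :=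
    (component s.s π).restrict fun _ => component_mem_properStalk s.s
  have hf : Function.Injective f := fun x y h => Subtype.ext (hinj π (congrArg Subtype.val h))
  have hsurj := (LinearMap.injective_iff_surjective_of_finrank_eq_finrank heq).1 hf
  let w : S.X₁.obj π := component e.inv π (indecOne k π)
  have hw : w ∈ properStalk S.X₁ π := component_mem_properStalk _ (indecOne_mem π)
  obtain ⟨y, hy⟩ := hsurj ⟨component S.f π w, component_mem_properStalk _ hw⟩
  have hy' : component s.s π y = component S.f π w := congrArg Subtype.val hy
  have h1 : component s.r π (component S.f π w) = w := by
    rw [← component_comp, s.f_r, component_id]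
  rw [← hy', ← component_comp, s.s_r, component_zero] at h1
  apply indecOne_ne_zero (k := k) π
  have h2 : component e.hom π w = indecOne k π := by
    rw [← component_comp, e.inv_hom_id, component_id]
  rw [← h2, ← h1, map_zero]

end SplitOff

/-! ### Homology of some simple complexes. -/

section QuasiIso

variable {C : Type*} [Category* C] [Abelian C]

/-- In a short exact sequence of cochain complexes with acyclic first term, the epimorphism is a
quasi-isomorphism. -/
theorem quasiIso_g_of_acyclic {S : ShortComplex (CochainComplex C ℤ)} (hS : S.ShortExact)
    (h : ∀ i, IsZero (S.X₁.homology i)) : QuasiIso S.g := by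
  rw [quasiIso_iff]
  intro i
  rw [quasiIsoAt_iff_isIso_homologyMap]
  have h1 : Mono (HomologicalComplex.homologyMap S.g i) :=
    (hS.homology_exact₂ i).mono_g ((h i).eq_of_src _ _)
  have h2 : Epi (HomologicalComplex.homologyMap S.g i) :=
    (hS.homology_exact₃ i (i + 1) rfl).epi_f ((h (i + 1)).eq_of_tgt _ _)
  exact isIso_of_mono_of_epi _

/-- The differential is invertible, so there are no cycles in degree `m` and every cycle in degree
`n` is a boundary. -/
theorem isZero_homology_double (X : C) {m n : ℤ} (h : (ComplexShape.up ℤ).Rel m n) (i : ℤ) :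
    IsZero ((HomologicalComplex.double (𝟙 X) h).homology i) := by
  have hmn : m ≠ n := by
    intro e
    have : m + 1 = n := h
    omega
  let K := HomologicalComplex.double (𝟙 X) h
  have hd : IsIso (K.d m n) := by
    rw [HomologicalComplex.double_d (𝟙 X) h hmn]
    infer_instance
  have hπ (h0 : K.homologyπ i = 0) : IsZero (K.homology i) := by
    rw [IsZero.iff_id_eq_zero, ← cancel_epi (K.homologyπ i), h0, zero_comp, zero_comp]
  have hι (h0 : K.iCycles i = 0) : IsZero (K.homology i) := by
    apply hπ
    have h1 : 𝟙 (K.cycles i) = 0 := by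
      rw [← cancel_mono (K.iCycles i), h0, comp_zero, comp_zero]
    rw [← Category.id_comp (K.homologyπ i), h1, zero_comp]
  by_cases him : i = m
  · subst him
    apply hι
    rw [← cancel_mono (K.d i n), K.iCycles_d, zero_comp]
  by_cases hin : i = n
  · subst hin
    apply hπ
    have h1 : K.toCycles m i ≫ K.iCycles i = K.d m i := K.toCycles_i m i
    have h2 : Epi (K.iCycles i) := by
      have : Epi (K.toCycles m i ≫ K.iCycles i) := by rw [h1]; infer_instance
      exact epi_of_epi (K.toCycles m i) _
    have h3 : IsIso (K.iCycles i) := isIso_of_mono_of_epi _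
    have h4 : IsIso (K.toCycles m i) := by
      have : IsIso (K.toCycles m i ≫ K.iCycles i) := by rw [h1]; infer_instance
      exact IsIso.of_isIso_comp_right _ (K.iCycles i)
    rw [← cancel_epi (K.toCycles m i), K.toCycles_comp_homologyπ, comp_zero]
  · exact hι ((HomologicalComplex.isZero_double_X (𝟙 X) h i him hin).eq_of_tgt _ _)

theorem nonempty_homology_iso_of_zero (A : CochainComplex C ℤ) (hA : ∀ i j, A.d i j = 0) (i : ℤ) :
    Nonempty (A.homology i ≅ A.X i) := by
  have : IsIso (A.iCycles i) := A.isIso_iCycles i (i+1) (by simp) (hA _ _)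
  have : IsIso (A.homologyπ i) := A.isIso_homologyπ (i-1) i (by simp) (hA _ _)
  exact ⟨(asIso (A.homologyπ i)).symm ≪≫ asIso (A.iCycles i)⟩

end QuasiIso

/-! ### Minimal complexes. -/

section Minimal

variable {k : Type u} [Field k] {P : Type v} [PartialOrder P]

theorem QuasiIsomorphic.nonempty_iso {I J : Complex k P} (h : QuasiIsomorphic I J) (i : ℤ) :
    Nonempty (I.homology i ≅ J.homology i) := by
  induction h with
  | rel _ _ h =>
    obtain ⟨f, hf⟩ := h
    exact ⟨asIso (HomologicalComplex.homologyMap f i)⟩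
  | refl _ => exact ⟨Iso.refl _⟩
  | symm _ _ _ ih => exact ⟨ih.some.symm⟩
  | trans _ _ _ _ _ ih₁ ih₂ => exact ⟨ih₁.some ≪≫ ih₂.some⟩

instance injective_of_subsingleton [Subsingleton P] (F : Sheaf k P) : Injective F where
  factors {A B} g f _ := by
    choose r hr using fun π => LinearMap.exists_leftInverse_of_injective (component f π)
      (LinearMap.ker_eq_bot.2 (component_injective_of_mono f π))
    refine ⟨homMk (fun π => component g π ∘ₗ r π) ?_, ?_⟩
    · intro σ τ h x
      obtain rfl := Subsingleton.elim σ τ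
      simp
    · exact hom_ext_component fun σ x => congrArg (component g σ) (LinearMap.congr_fun (hr σ) x)

theorem numSummands_le_of_epi [Subsingleton P] {F G : Sheaf k P}
    (η : F ⟶ G) [Epi η] : numSummands G ≤ numSummands F := by
  choose r hr using fun π => LinearMap.exists_rightInverse_of_surjective (component η π)
    (LinearMap.range_eq_top.2 (component_surjective_of_epi η π))
  let s : G ⟶ F := homMk r (by
    intro σ τ h x
    obtain rfl := Subsingleton.elim σ τ
    simp)
  have hs : s ≫ η = 𝟙 G := hom_ext_component fun σ x => LinearMap.congr_fun (hr σ) x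
  have : Mono s := mono_of_mono_fac hs
  exact numSummands_le_of_mono s

/-- Every nonzero section of `[π]` restricts to a nonzero multiple of the generator at `π`. -/
theorem mono_of_indecOne_ne_zero {F : Sheaf k P} {π : P} (η : indec k π ⟶ F)
    (h : component η π (indecOne k π) ≠ 0) : Mono η := by
  refine mono_of_component_injective η fun σ => (injective_iff_map_eq_zero _).2 fun x hx => ?_
  by_cases hσ : σ ≤ π
  · apply indec_restriction_injective hσ
    obtain ⟨c, hc⟩ := eq_smul_indecOne (restriction (indec k π) hσ x)
    have h1 := component_restriction η hσ x
    rw [hx, map_zero, hc, map_smul] at h1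
    rw [hc, (smul_eq_zero.1 h1).resolve_right h, zero_smul, map_zero]
  · exact indec_eq_zero hσ x

/-- On a one-element poset, a bounded complex with zero differentials is minimal. -/
theorem isMinimal_of_zero [Subsingleton P] (A : Complex k P) (hA : ∀ i j, A.d i j = 0)
    (hb : ∃ N : ℕ, ∀ d : ℤ, (N : ℤ) < |d| → IsZero (A.X d)) : IsMinimal A where
  bounded := hb
  injective _ := inferInstance
  minimal J _ hAJ d := by
    obtain ⟨e⟩ := hAJ.nonempty_iso d
    obtain ⟨e'⟩ := nonempty_homology_iso_of_zero A hA d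
    -- `A.X d` is isomorphic to the homology of `J`, a quotient of a subobject of `J.X d`.
    exact (numSummands_le_of_mono (e'.inv ≫ e.hom)).trans
      ((numSummands_le_of_epi (J.homologyπ d)).trans (numSummands_le_of_mono (J.iCycles d)))

/-- The differentials of a minimal complex vanish on proper stalks. -/
theorem IsMinimal.d_eq_zero [Finite P] {I : Complex k P} (hI : IsMinimal I) (m n : ℤ) {π : P}
    {v : (I.X m).obj π} (hv : v ∈ properStalk (I.X m) π) : component (I.d m n) π v = 0 := by
  by_contra hne
  have hrel : (ComplexShape.up ℤ).Rel m n := by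
    by_contra h
    rw [I.shape _ _ h] at hne
    exact hne rfl
  have hmn : m ≠ n := by
    intro e
    have : m + 1 = n := hrel
    omega
  have hinj := hI.injective
  obtain ⟨e, he⟩ := exists_hom_of_mem_properStalk hv
  -- Both `e` and `e ≫ d` are nonzero on the generator, hence monic, so this acyclic complex embeds
  -- in `I`.
  let E := HomologicalComplex.double (𝟙 (indec k π)) hrel
  let φ : E ⟶ I := HomologicalComplex.mkHomFromDouble hrel hmn e (e ≫ I.d m n) (by simp) (by simp)
  have hEinj i : Injective (E.X i) := by
    by_cases h0 : i = m
    · subst h0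
      exact Injective.of_iso (HomologicalComplex.doubleXIso₀ _ hrel).symm inferInstance
    by_cases h1 : i = n
    · subst h1
      exact Injective.of_iso (HomologicalComplex.doubleXIso₁ _ hrel hmn).symm inferInstance
    · exact (HomologicalComplex.isZero_double_X _ hrel i h0 h1).injective
  have hφ i : Mono (φ.f i) := by
    by_cases h0 : i = m
    · subst h0
      rw [HomologicalComplex.mkHomFromDouble_f₀]
      have : Mono e := mono_of_indecOne_ne_zero e fun h => hne (by rw [← he, h, map_zero])
      infer_instance
    by_cases h1 : i = n
    · subst h1
      rw [HomologicalComplex.mkHomFromDouble_f₁]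
      have : Mono (e ≫ I.d m i) := mono_of_indecOne_ne_zero _ (by rwa [component_comp, he])
      infer_instance
    · exact ⟨fun _ _ _ => (HomologicalComplex.isZero_double_X _ hrel i h0 h1).eq_of_tgt _ _⟩
  have : Mono φ := HomologicalComplex.mono_of_mono_f _ hφ
  let S := ShortComplex.mk φ (cokernel.π φ) (by simp)
  have hS : S.ShortExact := { exact := ShortComplex.exact_cokernel _ }
  have hSi i : (S.map (HomologicalComplex.eval _ _ i)).ShortExact :=
    hS.map_of_exact (HomologicalComplex.eval _ _ i)
  -- The terms of `E` are injective, so the quotient is termwise a retract of `I` and competes with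
  -- it for minimality.
  have hsp i : Nonempty (S.map (HomologicalComplex.eval _ _ i)).Splitting := by
    have : Injective (S.map (HomologicalComplex.eval _ _ i)).X₁ := hEinj i
    exact ⟨(hSi i).splittingOfInjective⟩
  have hJinj i : Injective ((cokernel φ).X i) := by
    obtain ⟨s⟩ := hsp i
    have : Injective (S.map (HomologicalComplex.eval _ _ i)).X₂ := hinj i
    exact (Retract.mk s.s _ s.s_g).injective
  have hJ : IsBoundedInjective (cokernel φ) := by
    refine ⟨?_, hJinj⟩
    obtain ⟨N, hN⟩ := hI.bounded
    refine ⟨N, fun d hd => ?_⟩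
    obtain ⟨s⟩ := hsp d
    rw [IsZero.iff_id_eq_zero]
    have h1 : s.s = 0 := (hN d hd).eq_of_tgt _ _
    exact s.s_g.symm.trans (by rw [h1, zero_comp]; rfl)
  have hqi : QuasiIsomorphic I (cokernel φ) :=
    Relation.EqvGen.rel _ _ ⟨cokernel.π φ,
      quasiIso_g_of_acyclic hS (isZero_homology_double (indec k π) hrel)⟩
  obtain ⟨s⟩ := hsp m
  have : Injective (S.map (HomologicalComplex.eval _ _ m)).X₂ := hinj m
  have : Injective (S.map (HomologicalComplex.eval _ _ m)).X₃ := hJinj m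
  have hlt : numSummands ((cokernel φ).X m) < numSummands (I.X m) :=
    numSummands_lt_of_splitting s (HomologicalComplex.doubleXIso₀ (𝟙 (indec k π)) hrel)
  exact hlt.not_ge (hI.minimal _ hJ hqi m)

end Minimal

/-! ### The two supports and their closures. -/

section Support

variable {k : Type u} [Field k] {P : Type v} [PartialOrder P]

/-- A derived image under a functor to sheaves on a one-element poset has nonzero homology only if
some term of the complex it resolves is nonzero. -/
theorem exists_not_isZero_of_resolution {Q : Type w} [PartialOrder Q] {A K : Complex k Q}
    (h : IsMinimalInjectiveResolution A K) (hK : ∃ j, ¬ IsZero (K.homology j)) :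
    ∃ j, ¬ IsZero (A.X j) := by
  obtain ⟨_, α, hα⟩ := h
  obtain ⟨j, hj⟩ := hK
  refine ⟨j, fun h0 => hj ?_⟩
  have h1 : IsZero (A.homology j) := (A.exactAt_iff_isZero_homology j).1 (by
    rw [HomologicalComplex.exactAt_iff]
    exact ShortComplex.exact_of_isZero_X₂ _ h0)
  exact h1.of_iso (asIso (HomologicalComplex.homologyMap α j)).symm

/-- Such a complex is its own minimal resolution, and its homology is its terms. -/
theorem exists_resolution_iff_of_zero {Q : Type w} [PartialOrder Q] [Subsingleton Q]
    {A : Complex k Q} (hA : ∀ i j, A.d i j = 0)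
    (hb : ∃ N : ℕ, ∀ d : ℤ, (N : ℤ) < |d| → IsZero (A.X d)) :
    (∃ K, IsMinimalInjectiveResolution A K ∧ ∃ j, ¬ IsZero (K.homology j)) ↔
      ∃ j, ¬ IsZero (A.X j) := by
  constructor
  · rintro ⟨K, hK, h⟩
    exact exists_not_isZero_of_resolution hK h
  · rintro ⟨j, hj⟩
    refine ⟨A, ⟨isMinimal_of_zero A hA hb, 𝟙 A, inferInstance⟩, j, fun h => hj ?_⟩
    exact h.of_iso (nonempty_homology_iso_of_zero A hA j).some.symm

theorem bounded_map {Q : Type w} [PartialOrder Q] (F : Sheaf k P ⥤ Sheaf k Q)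
    [F.PreservesZeroMorphisms] {I : Complex k P}
    (hb : ∃ N : ℕ, ∀ d : ℤ, (N : ℤ) < |d| → IsZero (I.X d)) :
    ∃ N : ℕ, ∀ d : ℤ, (N : ℤ) < |d| →
      IsZero (((F.mapHomologicalComplex (ComplexShape.up ℤ)).obj I).X d) := by
  obtain ⟨N, hN⟩ := hb
  exact ⟨N, fun d hd => F.map_isZero (hN d hd)⟩

theorem isZero_properPullback_iff (F : Sheaf k P) (π : P) :
    IsZero ((properPullback k ({π} : Set P)).obj F) ↔ properStalk F π = ⊥ := by
  rw [isZero_iff_subsingleton, Submodule.eq_bot_iff]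
  constructor
  · intro h x hx
    exact congrArg Subtype.val (h ⟨π, rfl⟩ ⟨x, hx⟩)
  · rintro h ⟨σ, rfl⟩ x
    exact Subtype.ext (h x.1 x.2)

theorem isZero_pullback_iff (F : Sheaf k P) (π : P) :
    IsZero ((pullback k (OrderHom.Subtype.val (· ∈ ({π} : Set P)))).obj F) ↔
      ∀ x : F.obj π, x = 0 := by
  rw [isZero_iff_subsingleton]
  constructor
  · intro h x
    exact h ⟨π, rfl⟩ x
  · rintro h ⟨σ, rfl⟩ x
    exact h x

theorem mem_shriekSupport_iff [Finite P] {I : Complex k P} (hI : IsMinimal I) (π : P) :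
    π ∈ shriekSupport I ↔ ∃ d, properStalk (I.X d) π ≠ ⊥ := by
  refine (exists_resolution_iff_of_zero ?_ (bounded_map _ hI.bounded)).trans
    (exists_congr fun d => (isZero_properPullback_iff (I.X d) π).not)
  intro i j
  apply hom_ext_component
  rintro ⟨σ, rfl⟩ x
  exact Subtype.ext (hI.d_eq_zero i j x.2)

/-- The converse fails in general: the stalk complex may be acyclic with nonzero terms. -/
theorem exists_ne_zero_of_mem_starSupport {I : Complex k P} {π : P} (h : π ∈ starSupport I) :
    ∃ (d : ℤ) (x : (I.X d).obj π), x ≠ 0 := by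
  obtain ⟨K, hK, hj⟩ := h
  obtain ⟨d, hd⟩ := exists_not_isZero_of_resolution hK hj
  refine ⟨d, ?_⟩
  by_contra! hx
  exact hd ((isZero_pullback_iff (I.X d) π).2 hx)

/-- A nonzero section restricts to a nonzero proper section at some larger element. -/
theorem exists_properStalk_ne_bot [Finite P] {F : Sheaf k P} {π : P} {x : F.obj π} (hx : x ≠ 0) :
    ∃ σ, π ≤ σ ∧ properStalk F σ ≠ ⊥ := by
  -- At a maximal `σ` where `x` survives, all further restrictions vanish.
  obtain ⟨σ, ⟨h, hσ⟩, hmax⟩ :=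
    (Set.toFinite {σ : P | ∃ h : π ≤ σ, restriction F h x ≠ 0}).exists_maximal
      ⟨π, le_rfl, by simpa using hx⟩
  refine ⟨σ, h, fun hbot => hσ ((Submodule.eq_bot_iff _).1 hbot _ ?_)⟩
  rw [mem_properStalk]
  intro τ hτ hne
  rw [restriction_restriction]
  by_contra h0
  exact hne (le_antisymm (hmax ⟨h.trans hτ, h0⟩ hτ) hτ)

/-- A section at `σ` surviving at a larger element would yield a point of the `!`-support above `σ`.
So every section at `σ` is proper, and the stalk complex has zero differentials. -/
theorem mem_starSupport_of_maximal [Finite P] {I : Complex k P} (hI : IsMinimal I) {σ : P}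
    (h : Maximal (· ∈ shriekSupport I) σ) : σ ∈ starSupport I := by
  have hproper d (x : (I.X d).obj σ) : x ∈ properStalk (I.X d) σ := by
    rw [mem_properStalk]
    intro τ hτ hne
    by_contra h0
    obtain ⟨ρ, hρ, hbot⟩ := exists_properStalk_ne_bot h0
    have h1 := h.2 ((mem_shriekSupport_iff hI ρ).2 ⟨d, hbot⟩) (hτ.trans hρ)
    exact hne (le_antisymm (hρ.trans h1) hτ)
  refine (exists_resolution_iff_of_zero ?_ (bounded_map _ hI.bounded)).2 ?_
  · intro i j
    apply hom_ext_component
    rintro ⟨τ, rfl⟩ x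
    exact hI.d_eq_zero i j (hproper i x)
  · obtain ⟨d, hd⟩ := (mem_shriekSupport_iff hI σ).1 h.1
    refine ⟨d, fun h0 => hd ?_⟩
    exact (Submodule.eq_bot_iff _).2 fun x _ => (isZero_pullback_iff (I.X d) σ).1 h0 x

theorem alexandrovClosure_eq (S : Set P) : alexandrovClosure S = lowerClosure S := by
  let _ : TopologicalSpace P := Topology.upperSet P
  have : Topology.IsUpperSet P := ⟨rfl⟩
  exact Topology.IsUpperSet.closure_eq_lowerClosure

end Support

end PosetSheaf

end

theorem mainTheorem9 {k : Type u} [Field k] {P : Type v} [PartialOrder P] [Finite P]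
    (I : PosetSheaf.Complex k P) (hI : PosetSheaf.IsMinimal I) :
    (∀ π : P, π ∉ PosetSheaf.shriekSupport I ↔
      ∀ d : ℤ, PosetSheaf.multiplicity (I.X d) π = 0) ∧
    PosetSheaf.alexandrovClosure (PosetSheaf.shriekSupport I) =
      PosetSheaf.alexandrovClosure (PosetSheaf.starSupport I) := by
  constructor
  · intro π
    have := hI.injective
    simp only [PosetSheaf.mem_shriekSupport_iff hI, PosetSheaf.multiplicity_eq_zero_iff, not_exists,
      not_not]
  · rw [PosetSheaf.alexandrovClosure_eq, PosetSheaf.alexandrovClosure_eq]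
    congr 1
    apply le_antisymm
    · rw [lowerClosure_le]
      intro π hπ
      obtain ⟨σ, hσ, hmax⟩ := (Set.toFinite (PosetSheaf.shriekSupport I)).exists_le_maximal hπ
      exact ⟨σ, PosetSheaf.mem_starSupport_of_maximal hI hmax, hσ⟩
    · rw [lowerClosure_le]
      intro π hπ
      obtain ⟨d, x, hx⟩ := PosetSheaf.exists_ne_zero_of_mem_starSupport hπ
      obtain ⟨σ, hσ, hbot⟩ := PosetSheaf.exists_properStalk_ne_bot hx
      exact ⟨σ, (PosetSheaf.mem_shriekSupport_iff hI σ).2 ⟨d, hbot⟩, hσ⟩
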